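/- Notation. For $c,d>0$ let $\beta^{(2)}_{c,d}$ be the law on $(0,\infty)$ with density $\frac{1}{B(c,d)}\frac{w^{c-1}}{(1+w)^{c+d}}$. For $\theta=(\theta_1,\dots,\theta_5)\in\mathbb R^5$ put $$a=\theta_4+\theta_5,\quad b=\theta_1+\theta_3,\quad p=\theta_3+\theta_5,\quad q=\theta_3+\theta_4,\quad r=\theta_2+\theta_3+\theta_4+\theta_5 .$$ We say that $BH_\theta$ exists if $r\notin\{0,-1,-2,\dots\}$, ${}_2F_1(p,q;r;x)>0$ for all $x\in(0,1)$, and $a,\ b,\ r+b-p-q>0$. In this case $BH_\theta$ is the probability law on $(0,1)$ with density proportional to $x^{a-1}(1-x)^{b-1}{}_2F_1(p,q;r;x)$. Existence of $BH_\theta$ and the law itself depend only on the triple $v_\theta=(\theta_1,\{\theta_2,\theta_3\},\{\theta_4,\theta_5\})$, where the pairs are unordered (multisets), so we write $BH_v$ for $v=v_\theta$. Fix $\theta\in\mathbb R^5$. The vertices of the finite directed graph $G_\theta$ are the triples $v_{\theta'}$, where $\theta'$ runs through the rearrangements of $(\theta_1,\dots,\theta_5)$. From a vertex $v=(\eta_1,\{\eta_2,\eta_3\},\{\eta_4,\eta_5\})$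 there are edges to $(\eta_5,\{\eta_1,\eta_4\},\{\eta_2,\eta_3\})$ and to $(\eta_4,\{\eta_1,\eta_5\},\{\eta_2,\eta_3\})$ (which may coincide). Such an edge is acceptable if $\eta_2+\eta_3>0$ and, respectively, $\eta_1+\eta_5>0$ or $\eta_1+\eta_4>0$; to an acceptable edge $(v,v')$ we attach the law $\beta^{(v,v')}=\beta^{(2)}_{\eta_1+\eta_5,\,\eta_2+\eta_3}$, respectively $\beta^{(2)}_{\eta_1+\eta_4,\,\eta_2+\eta_3}$. The graph $G^{**}_\theta$ is obtained from $G_\theta$ by removing all edges that are not acceptable, and all vertices $v$ for which $BH_v$ does not exist together with their adjacent edges. **Theorem 4.2.** Let $\cdots\to v_n\to v_{n-1}\to\cdots\to v_2\to v_1\to v_0$ be an infinite path in $G^{**}_\theta$ (its vertices need not be distinct), and let $W_1,W_2,\dots$ be independent random variables with $W_n\sim\beta^{(v_n,v_{n-1})}$ for all $n\ge1$. Put $H_w(x)=\frac1{1+wx}$ and $Z_n(x)=H_{W_1}\circ H_{W_2}\circ\cdots\circ H_{W_n}(x)$ for $x\ge0$. Then almost surely the limit $$Z=\lim_{n\to\infty}Z_n(x)=\cfrac{1}{1+\cfrac{W_1}{1+\cfrac{W_2}{1+\cdots}}}$$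 exists for all $x\ge 0$ and does not depend on $x$. Moreover $Z\sim BH_{v_0}$. -/

import Mathlib

open MeasureTheory ProbabilityTheory Filter Topology

noncomputable section

namespace BetaHyp

/-- The function `h(a,b,p,q,r;x) = x^(a-1) (1-x)^(b-1) ₂F₁(p,q;r;x)`, used for `0 < x < 1`. -/
def h (a b p q r x : ℝ) : ℝ :=
  x ^ (a - 1) * (1 - x) ^ (b - 1) * ordinaryHypergeometric p q r x

/-- The set of admissible parameters `(a,b,p,q,r)` of the beta hypergeometric distributions. -/
def Admissible (a b p q r : ℝ) : Prop :=
  (∀ n : ℕ, r ≠ -(n : ℝ)) ∧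
  (∀ x ∈ Set.Ioo (0 : ℝ) 1, 0 < ordinaryHypergeometric p q r x) ∧
  0 < a ∧ 0 < b ∧ 0 < r + b - p - q

/-- The measure `h(a,b,p,q,r;x) dx` on `(0,1)`. -/
def unnormalizedBH (a b p q r : ℝ) : Measure ℝ :=
  (volume.restrict (Set.Ioo (0 : ℝ) 1)).withDensity fun x => ENNReal.ofReal (h a b p q r x)

/-- The law `BH(a,b,p,q,r)` on `(0,1)` whose density is proportional to `h(a,b,p,q,r;x)`.
It is meaningful for admissible parameters, for which the total mass of
`h(a,b,p,q,r;x) dx` is positive and finite. -/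
def BH (a b p q r : ℝ) : Measure ℝ :=
  (unnormalizedBH a b p q r Set.univ)⁻¹ • unnormalizedBH a b p q r

/-- The beta distribution of the second kind, with density
`w^(c-1) / (B(c,d) (1+w)^(c+d))` on `(0,∞)`. It is meaningful for `c, d > 0`. -/
def betaPrime (c d : ℝ) : Measure ℝ :=
  (volume.restrict (Set.Ioi (0 : ℝ))).withDensity fun w =>
    ENNReal.ofReal (1 / ProbabilityTheory.beta c d * (w ^ (c - 1) / (1 + w) ^ (c + d)))

/-! The parameters `θ₁, …, θ₅` are `θ 0, …, θ 4`. -/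

/-- `BH_θ` exists: `a = θ₄+θ₅`, `b = θ₁+θ₃`, `p = θ₃+θ₅`, `q = θ₃+θ₄`, `r = θ₂+θ₃+θ₄+θ₅`
are admissible. -/
def ThetaAdmissible (θ : Fin 5 → ℝ) : Prop :=
  Admissible (θ 3 + θ 4) (θ 0 + θ 2) (θ 2 + θ 4) (θ 2 + θ 3) (θ 1 + θ 2 + θ 3 + θ 4)

/-- The law `BH_θ`, in the same parameters. -/
def BHθ (θ : Fin 5 → ℝ) : Measure ℝ :=
  BH (θ 3 + θ 4) (θ 0 + θ 2) (θ 2 + θ 4) (θ 2 + θ 3) (θ 1 + θ 2 + θ 3 + θ 4)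

/-- Triples consisting of a number and two unordered pairs (multisets of two elements). -/
abbrev Triple : Type := ℝ × Sym2 ℝ × Sym2 ℝ

/-- `v_θ = (θ₁, {θ₂, θ₃}, {θ₄, θ₅})`. -/
def triple (θ : Fin 5 → ℝ) : Triple := (θ 0, s(θ 1, θ 2), s(θ 3, θ 4))

/-- `v₁ = (θ₅, {θ₁, θ₄}, {θ₂, θ₃})`. -/
def succ₁ (θ : Fin 5 → ℝ) : Triple := (θ 4, s(θ 0, θ 3), s(θ 1, θ 2))

/-- `v₂ = (θ₄, {θ₁, θ₅}, {θ₂, θ₃})`. -/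
def succ₂ (θ : Fin 5 → ℝ) : Triple := (θ 3, s(θ 0, θ 4), s(θ 1, θ 2))

/-- The edges `v_θ → v₁` and `v_θ → v₂`. -/
def IsEdge (v v' : Triple) : Prop :=
  ∃ θ : Fin 5 → ℝ, v = triple θ ∧ (v' = succ₁ θ ∨ v' = succ₂ θ)

/-- An edge from `v_θ` is acceptable if `θ₂+θ₃ > 0` and moreover `θ₁+θ₅ > 0` for the edge to `v₁`,
`θ₁+θ₄ > 0` for the edge to `v₂`. -/
def IsAcceptable (v v' : Triple) : Prop :=
  ∃ θ : Fin 5 → ℝ, v = triple θ ∧ 0 < θ 1 + θ 2 ∧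
    ((v' = succ₁ θ ∧ 0 < θ 0 + θ 4) ∨ (v' = succ₂ θ ∧ 0 < θ 0 + θ 3))

/-- The law `BH_v` attached to the triple `v` exists. -/
def BHExists (v : Triple) : Prop := ∃ θ : Fin 5 → ℝ, triple θ = v ∧ ThetaAdmissible θ

/-- The vertices of `G_θ`: all triples obtained by rearranging the numbers `θ₁, …, θ₅`. -/
def Vert (θ : Fin 5 → ℝ) : Set Triple := {v | ∃ σ : Equiv.Perm (Fin 5), v = triple (θ ∘ σ)}

/-- The directed graph `G_θ`. -/
def G (θ : Fin 5 → ℝ) : Digraph (Vert θ) where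
  Adj v v' := IsEdge v v'

/-- The directed graph `G*_θ`: the non acceptable edges of `G_θ` are removed. -/
def Gstar (θ : Fin 5 → ℝ) : Digraph (Vert θ) where
  Adj v v' := (G θ).Adj v v' ∧ IsAcceptable v v'

/-- The directed graph `G**_θ`: the vertices `v` of `G*_θ` for which `BH_v` does not exist are
removed, with the adjacent edges. -/
def Gstarstar (θ : Fin 5 → ℝ) : Digraph {v : Vert θ // BHExists v} where
  Adj v v' := (Gstar θ).Adj v.1 v'.1

/-- The law `β^(v,v')` attached to an edge. The first components of `v_θ` and `v₁` add up
to `θ₁+θ₅`, those of `v_θ` and `v₂` to `θ₁+θ₄`, and the first pair of `v_θ` has sum `θ₂+θ₃`. -/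
def edgeLaw (v v' : Triple) : Measure ℝ := betaPrime (v.1 + v'.1) v.2.1.add

theorem edgeLaw_succ₁ (θ : Fin 5 → ℝ) :
    edgeLaw (triple θ) (succ₁ θ) = betaPrime (θ 0 + θ 4) (θ 1 + θ 2) := rfl

theorem edgeLaw_succ₂ (θ : Fin 5 → ℝ) :
    edgeLaw (triple θ) (succ₂ θ) = betaPrime (θ 0 + θ 3) (θ 1 + θ 2) := rfl

/-- The Moebius transformation `H_w(x) = 1 / (1 + w x)`. -/
def moebius (w x : ℝ) : ℝ := 1 / (1 + w * x)

/-- `Z w n x = H_{w 0} ∘ H_{w 1} ∘ ⋯ ∘ H_{w (n-1)} (x)`. -/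
def Z (w : ℕ → ℝ) : ℕ → ℝ → ℝ
  | 0, x => x
  | n + 1, x => Z w n (moebius (w n) x)

end BetaHyp

end

/-!
Euler's transformation `₂F₁(p,q;r;x) = (1-x)^(r-p-q) ₂F₁(r-p,r-q;r;x)` and the symmetry in `p, q`
make `BH_θ` depend only on `v_θ`.

If `W ∼ β^(v,v')` and `X ∼ BH_v` are independent, then `H_W(X) ∼ BH_{v'}`. Indeed, changing
variables from `w` to `y = H_w(x)`, the density of `H_W(X)` at `y` is a beta density times
`∫ h(r,b,p,q,r;x) (1 - y(1-x))^(-s) dx` with `s = r+b-q`. Expand the last factor in powers of `y`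
and integrate termwise: the coefficients involve the masses `M(b) = ∫ h(r,b,p,q,r;x) dx`, and the
contiguous relation `(r+b-p)(r+b-q) M(b+1) = b(r+b-p-q) M(b)`, which follows by telescoping, shows
that the sum is `M(b) ₂F₁(b,r+b-p-q;r+b-p;y)`.

On `[0,1]` the map `H_w` contracts the relative distance by the factor `w/(1+w)`. As the graph is
finite, the probabilities of `W_n ≤ 1` are bounded below, so by Borel–Cantelli this event occurs
infinitely often almost surely, and `Z_n(x_n)` converges to a limit `Z` which does not depend on the
starting points `x_n ≥ 0`. Starting from `X_n ∼ BH_{v_n}` independent of the `W_k`, the law of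
`Z_n(X_n)` is `BH_{v_0}` for every `n`, hence so is the law of `Z`.
-/

noncomputable section

namespace BetaHyp

/-! ### The hypergeometric series and Euler's transformation -/

section Coefficients

variable {K : Type*} [Field K]

/-- The coefficient of `x ^ n` in `₂F₁(p,q;r;x)`; unlike Mathlib's abbreviation
`ordinaryHypergeometricCoefficient` it is an atom for `ring` and `field_simp`. -/
def hgCoeff (p q r : K) (n : ℕ) : K := ordinaryHypergeometricCoefficient p q r n

theorem hgCoeff_zero (p q r : K) : hgCoeff p q r 0 = 1 := by
  simp [hgCoeff, ordinaryHypergeometricCoefficient]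

variable [CharZero K]

theorem hgCoeff_succ (p q : K) {r : K} {n : ℕ} (hr : r ≠ -(n : K)) :
    (n + 1) * (r + n) * hgCoeff p q r (n + 1) = (p + n) * (q + n) * hgCoeff p q r n := by
  have hrn : r + n ≠ 0 := fun h => hr (eq_neg_of_add_eq_zero_left h)
  have hn : (n : K) + 1 ≠ 0 := n.cast_add_one_ne_zero
  simp only [hgCoeff, ordinaryHypergeometricCoefficient, ascPochhammer_succ_eval,
    Nat.factorial_succ, Nat.cast_mul, Nat.cast_succ, mul_inv]
  field_simp

theorem eq_hgCoeff_of_recurrence {p q r : K} (hr : ∀ n : ℕ, r ≠ -(n : K)) {f : ℕ → K}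
    (h0 : f 0 = 1)
    (hf : ∀ n : ℕ, (n + 1) * (r + n) * f (n + 1) = (p + n) * (q + n) * f n) :
    f = hgCoeff p q r := by
  funext n
  induction n with
  | zero => rw [h0, hgCoeff_zero]
  | succ n ih =>
    have hrn : r + n ≠ 0 := fun h => hr n (eq_neg_of_add_eq_zero_left h)
    refine mul_left_cancel₀ (mul_ne_zero n.cast_add_one_ne_zero hrn) ?_
    rw [hf, hgCoeff_succ p q (hr n), ih]

theorem one_ne_neg_natCast (n : ℕ) : (1 : K) ≠ -(n : K) := fun h =>
  n.cast_add_one_ne_zero (R := K) (by rw [h, add_neg_cancel])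

theorem hgCoeff_one_one_succ (s : K) (n : ℕ) :
    (n + 1) * hgCoeff s 1 1 (n + 1) = (s + n) * hgCoeff s 1 1 n := by
  refine mul_left_cancel₀ (n.cast_add_one_ne_zero (R := K)) ?_
  linear_combination hgCoeff_succ s 1 (one_ne_neg_natCast (K := K) n)

theorem hgCoeff_one_one (s : K) (n : ℕ) :
    hgCoeff s 1 1 n = (n.factorial : K)⁻¹ * (ascPochhammer K n).eval s := by
  have : (n.factorial : K) ≠ 0 := Nat.cast_ne_zero.2 n.factorial_ne_zero
  rw [hgCoeff, ordinaryHypergeometricCoefficient, ascPochhammer_eval_one,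
    mul_inv_cancel_right₀ this]

end Coefficients

section PowerSeries

open PowerSeries

variable {K : Type*} [Field K]

/-- The hypergeometric series `₂F₁(p,q;r;X)` as a formal power series. -/
def hgSeries (p q r : K) : K⟦X⟧ := mk (hgCoeff p q r)

/-- The hypergeometric differential operator
`f ↦ X (1 - X) f'' + (r - (p + q + 1) X) f' - p q f` on formal power series; it annihilates
`₂F₁(p,q;r;X)`. -/
def hgOperator (p q r : K) (f : K⟦X⟧) : K⟦X⟧ :=
  X * (1 - X) * d⁄dX K (d⁄dX K f) + (C r - C (p + q + 1) * X) * d⁄dX K f - C (p * q) * f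

theorem coeff_hgOperator (p q r : K) (f : K⟦X⟧) (n : ℕ) :
    coeff n (hgOperator p q r f) =
      (n + 1) * (r + n) * coeff (n + 1) f - (p + n) * (q + n) * coeff n f := by
  have expand : hgOperator p q r f =
      X * d⁄dX K (d⁄dX K f) - X * (X * d⁄dX K (d⁄dX K f)) + C r * d⁄dX K f
        - C (p + q + 1) * (X * d⁄dX K f) - C (p * q) * f := by
    rw [hgOperator]; ring
  generalize hs : p + q + 1 = s at expand
  obtain rfl : q = s - p - 1 := by rw [← hs]; ring
  rw [expand]
  rcases n with _ | _ | n <;>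
  · simp only [map_add, map_sub, coeff_C_mul, coeff_succ_X_mul, coeff_derivative,
      coeff_zero_X_mul]
    push_cast
    ring

variable [CharZero K]

theorem eq_hgSeries_of_hgOperator_eq_zero {p q r : K} (hr : ∀ n : ℕ, r ≠ -(n : K)) {f : K⟦X⟧}
    (h0 : coeff 0 f = 1) (hf : hgOperator p q r f = 0) : f = hgSeries p q r := by
  have hcoeff : (fun n => coeff n f) = hgCoeff p q r :=
    eq_hgCoeff_of_recurrence hr h0 fun n => by
      rw [← sub_eq_zero, ← coeff_hgOperator, hf, map_zero]
  ext n
  rw [hgSeries, coeff_mk, ← hcoeff]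

theorem hgOperator_hgSeries (p q : K) {r : K} (hr : ∀ n : ℕ, r ≠ -(n : K)) :
    hgOperator p q r (hgSeries p q r) = 0 := by
  ext n
  rw [coeff_hgOperator, hgSeries, coeff_mk, coeff_mk, hgCoeff_succ p q (hr n), sub_self, map_zero]

theorem one_sub_X_mul_derivative_hgSeries (s : K) :
    (1 - X) * d⁄dX K (hgSeries s 1 1) = C s * hgSeries s 1 1 := by
  ext n
  rw [sub_mul, one_mul, map_sub, coeff_C_mul, hgSeries, coeff_derivative, coeff_mk, coeff_mk]
  rcases n with _ | n
  · rw [coeff_zero_X_mul]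
    linear_combination hgCoeff_one_one_succ s 0
  · rw [coeff_succ_X_mul, coeff_derivative, coeff_mk]
    have := hgCoeff_one_one_succ s (n + 1)
    push_cast at this ⊢
    linear_combination this

theorem hgOperator_mul_hgSeries {p q r : K} (hr : ∀ n : ℕ, r ≠ -(n : K)) :
    hgOperator p q r (hgSeries (p + q - r) 1 1 * hgSeries (r - p) (r - q) r) = 0 := by
  set B := hgSeries (p + q - r) 1 1
  set F := hgSeries (r - p) (r - q) r
  have hB' : (1 - X) * d⁄dX K B = C (p + q - r) * B := one_sub_X_mul_derivative_hgSeries _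
  have hB'' : (1 - X) * d⁄dX K (d⁄dX K B) = (C (p + q - r) + 1) * d⁄dX K B := by
    have := congrArg (d⁄dX K) hB'
    simp only [Derivation.leibniz, smul_eq_mul, map_sub, derivative_X, derivative_C,
      Derivation.map_one_eq_zero] at this ⊢
    linear_combination this
  have hF : hgOperator (r - p) (r - q) r F = 0 := hgOperator_hgSeries _ _ hr
  have h1X : (1 - X : K⟦X⟧) ≠ 0 := fun h => by simpa using congrArg (coeff 0) h
  refine (mul_eq_zero.1 (?_ : (1 - X) * hgOperator p q r (B * F) = 0)).resolve_left h1X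
  simp only [hgOperator, Derivation.leibniz, smul_eq_mul, map_add, map_sub, map_mul,
    map_one] at hF hB' hB'' ⊢
  linear_combination X * (1 - X) * F * hB'' + X * F * (C p + C q - C r + 1) * hB' +
    2 * X * (1 - X) * d⁄dX K F * hB' + (C r - (C p + C q + 1) * X) * F * hB' + (1 - X) * B * hF

theorem hgSeries_euler {p q r : K} (hr : ∀ n : ℕ, r ≠ -(n : K)) :
    hgSeries (p + q - r) 1 1 * hgSeries (r - p) (r - q) r = hgSeries p q r :=
  eq_hgSeries_of_hgOperator_eq_zero hr (by simp [hgSeries, hgCoeff_zero])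
    (hgOperator_mul_hgSeries hr)

end PowerSeries

section Hypergeometric

variable {𝕜 : Type*} [RCLike 𝕜]

theorem one_le_radius_ordinaryHypergeometricSeries (p q r : 𝕜) :
    1 ≤ (ordinaryHypergeometricSeries 𝕜 p q r).radius := by
  by_cases hp : ∃ k : ℕ, p = -(k : 𝕜)
  · obtain ⟨k, rfl⟩ := hp
    simp [ordinaryHypergeometric_radius_top_of_neg_nat₁]
  by_cases hq : ∃ k : ℕ, q = -(k : 𝕜)
  · obtain ⟨k, rfl⟩ := hq
    simp [ordinaryHypergeometric_radius_top_of_neg_nat₂]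
  by_cases hr : ∃ k : ℕ, r = -(k : 𝕜)
  · obtain ⟨k, rfl⟩ := hr
    simp [ordinaryHypergeometric_radius_top_of_neg_nat₃]
  push Not at hp hq hr
  exact (ordinaryHypergeometricSeries_radius_eq_one 𝕜 p q r fun k =>
    ⟨fun h => hp k (by simp [h]), fun h => hq k (by simp [h]), fun h => hr k (by simp [h])⟩).ge

theorem ordinaryHypergeometric_eq_tsum_hgCoeff (p q r x : 𝕜) :
    ₂F₁ p q r x = ∑' n, hgCoeff p q r n * x ^ n := by
  simp [hgCoeff, ordinaryHypergeometric_eq_tsum]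

theorem summable_norm_hgCoeff_mul_pow (p q r : 𝕜) {x : 𝕜} (hx : ‖x‖ < 1) :
    Summable fun n => ‖hgCoeff p q r n * x ^ n‖ := by
  have hmem : x ∈ Metric.eball (0 : 𝕜) (ordinaryHypergeometricSeries 𝕜 p q r).radius := by
    refine Metric.eball_subset_eball (one_le_radius_ordinaryHypergeometricSeries p q r) ?_
    rwa [mem_eball_zero_iff, ← ofReal_norm, ENNReal.ofReal_lt_one]
  refine ((ordinaryHypergeometricSeries 𝕜 p q r).summable_norm_apply hmem).congr fun n => ?_
  rw [ordinaryHypergeometricSeries_apply_eq, smul_eq_mul, hgCoeff]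

theorem hasSum_ordinaryHypergeometric (p q r : 𝕜) {x : 𝕜} (hx : ‖x‖ < 1) :
    HasSum (fun n => hgCoeff p q r n * x ^ n) (₂F₁ p q r x) := by
  rw [ordinaryHypergeometric_eq_tsum_hgCoeff]
  exact (summable_norm_hgCoeff_mul_pow p q r hx).of_norm.hasSum

theorem measurable_ordinaryHypergeometric (p q r : ℝ) : Measurable fun x : ℝ => ₂F₁ p q r x := by
  simp_rw [ordinaryHypergeometric_eq_tsum_hgCoeff]
  exact Measurable.tsum fun n => by fun_prop

theorem ordinaryHypergeometric_symm (p q r x : 𝕜) : ₂F₁ p q r x = ₂F₁ q p r x := by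
  simp only [ordinaryHypergeometric, ordinaryHypergeometricSeries_symm p q r]

theorem ordinaryHypergeometric_one_one (s : ℝ) {x : ℝ} (hx : |x| < 1) :
    ₂F₁ s 1 1 x = (1 - x) ^ (-s) := by
  have hcoeff : ∀ n : ℕ, Ring.choose (s + n - 1) n = hgCoeff s 1 1 n := by
    intro n
    have hfact : (n.factorial : ℝ) ≠ 0 := by positivity
    rw [hgCoeff_one_one, ← Polynomial.ascPochhammer_smeval_eq_eval,
      ← Ring.factorial_nsmul_multichoose_eq_ascPochhammer, nsmul_eq_mul,
      inv_mul_cancel_left₀ hfact, Ring.multichoose_eq]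
  have hbinom := (Real.one_div_one_sub_rpow_hasFPowerSeriesOnBall_zero s).hasSum_sub (y := x) (by
    simpa [← ENNReal.ofReal_one, Metric.eball_ofReal] using hx)
  rw [ordinaryHypergeometric_eq_tsum_hgCoeff, Real.rpow_neg (by linarith [(abs_lt.1 hx).2]),
    ← one_div, ← hbinom.tsum_eq]
  simp [hcoeff, mul_comm]

theorem ordinaryHypergeometric_euler (p q : ℝ) {r : ℝ} (hr : ∀ n : ℕ, r ≠ -(n : ℝ)) {x : ℝ}
    (hx : |x| < 1) :
    ₂F₁ p q r x = (1 - x) ^ (r - p - q) * ₂F₁ (r - p) (r - q) r x := by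
  have hpow : (1 - x) ^ (r - p - q) = ₂F₁ (p + q - r) 1 1 x := by
    rw [ordinaryHypergeometric_one_one _ hx]; congr 1; ring
  rw [hpow]
  simp only [ordinaryHypergeometric_eq_tsum_hgCoeff]
  rw [tsum_mul_tsum_eq_tsum_sum_antidiagonal_of_summable_norm
    (summable_norm_hgCoeff_mul_pow (p + q - r) 1 1 hx)
    (summable_norm_hgCoeff_mul_pow (r - p) (r - q) r hx)]
  refine tsum_congr fun n => ?_
  have hcoeff := congrArg (PowerSeries.coeff n) (hgSeries_euler (p := p) (q := q) hr)
  simp only [hgSeries, PowerSeries.coeff_mul, PowerSeries.coeff_mk] at hcoeff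
  rw [← hcoeff, Finset.sum_mul]
  refine Finset.sum_congr rfl fun kl hkl => ?_
  rw [← Finset.HasAntidiagonal.mem_antidiagonal.1 hkl, pow_add]
  ring

end Hypergeometric

/-! ### The normalizing constants -/

section Raabe

variable {t : ℕ → ℝ} {δ : ℝ}

theorem summable_of_raabe (ht : ∀ n, 0 ≤ t n) (hδ : 0 < δ)
    (h : ∀ᶠ n : ℕ in atTop, (n + 1) * t (n + 1) ≤ (n - δ) * t n) : Summable t := by
  obtain ⟨N, hN⟩ := eventually_atTop.1 h
  rw [← summable_nat_add_iff N]
  refine summable_of_sum_range_le (c := N * t N / δ) (fun n => ht _) fun n => ?_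
  have telescope : δ * ∑ i ∈ Finset.range n, t (i + N) ≤ N * t N - (n + N : ℕ) * t (n + N) := by
    induction n with
    | zero => simp
    | succ n ih =>
      have := hN (n + N) (by omega)
      rw [Finset.sum_range_succ, mul_add, add_right_comm n 1 N]
      push_cast at this ih ⊢
      linarith
  rw [le_div_iff₀ hδ, mul_comm]
  exact telescope.trans (sub_le_self _ (mul_nonneg (Nat.cast_nonneg _) (ht _)))

theorem eq_zero_of_summable_of_tendsto_natCast_mul (ht : Summable t) {L : ℝ}
    (hL : Tendsto (fun n : ℕ => n * t n) atTop (𝓝 L)) : L = 0 := by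
  by_contra hL0
  have hO : (fun n : ℕ => (n : ℝ)⁻¹) =O[atTop] t := by
    have := ((hL.inv₀ hL0).isBigO_one ℝ).mul (Asymptotics.isBigO_refl t atTop)
    simp only [one_mul] at this
    refine this.congr' ?_ .rfl
    filter_upwards [hL.eventually_ne hL0] with n hn
    field_simp [right_ne_zero_of_mul hn]
  exact Real.not_summable_natCast_inv (summable_of_isBigO_nat ht hO)

theorem tendsto_natCast_mul_of_raabe (ht : ∀ n, 0 ≤ t n) (hδ : 0 < δ)
    (h : ∀ᶠ n : ℕ in atTop, (n + 1) * t (n + 1) ≤ (n - δ) * t n) :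
    Tendsto (fun n : ℕ => n * t n) atTop (𝓝 0) := by
  obtain ⟨N, hN⟩ := eventually_atTop.1 h
  have hanti : Antitone fun n : ℕ => ((n + N : ℕ) : ℝ) * t (n + N) := by
    refine antitone_nat_of_succ_le fun n => ?_
    have hδt := mul_nonneg hδ.le (ht (n + N))
    have := hN (n + N) (by omega)
    rw [add_right_comm n 1 N]
    push_cast at this ⊢
    linarith
  have hbdd : BddBelow (Set.range fun n : ℕ => ((n + N : ℕ) : ℝ) * t (n + N)) :=
    ⟨0, Set.forall_mem_range.2 fun n => mul_nonneg (Nat.cast_nonneg _) (ht _)⟩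
  have hlim := (tendsto_add_atTop_iff_nat (f := fun n : ℕ => (n : ℝ) * t n) N).1
    (tendsto_atTop_ciInf hanti hbdd)
  rwa [eq_zero_of_summable_of_tendsto_natCast_mul (summable_of_raabe ht hδ h) hlim] at hlim

theorem eventually_natCast_add_pos (c : ℝ) : ∀ᶠ n : ℕ in atTop, 0 < c + n :=
  (tendsto_atTop_add_const_left _ c tendsto_natCast_atTop_atTop).eventually_gt_atTop 0

theorem eventually_mul_mul_le (p q a u v : ℝ) (hδ : δ < u + v - p - q - a) :
    ∀ᶠ n : ℕ in atTop, (p + n) * (q + n) * (a + n) ≤ (n - δ) * ((u + n) * (v + n)) := by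
  have hn := tendsto_natCast_atTop_atTop (R := ℝ)
  have hquad : Tendsto (fun n : ℕ => (n : ℝ) * ((u + v - p - q - a - δ) * n +
      (u * v - δ * (u + v) - (p * q + p * a + q * a))) + (-δ * u * v - p * q * a)) atTop atTop :=
    tendsto_atTop_add_const_right _ _ (hn.atTop_mul_atTop₀
      (tendsto_atTop_add_const_right _ _ (hn.const_mul_atTop (sub_pos.2 hδ))))
  filter_upwards [hquad.eventually_ge_atTop 0] with n hn
  linarith

end Raabe

section BetaIntegral

variable {a b : ℝ}

theorem beta_add_one_left (ha : 0 < a) (hb : 0 < b) :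
    beta (a + 1) b = beta a b * (a / (a + b)) := by
  have hab : a + b ≠ 0 := by positivity
  have hΓ : Real.Gamma (a + b) ≠ 0 := (Real.Gamma_pos_of_pos (by positivity)).ne'
  rw [beta, beta, Real.Gamma_add_one ha.ne', add_right_comm, Real.Gamma_add_one hab]
  field_simp

theorem beta_symm (a b : ℝ) : beta a b = beta b a := by
  rw [beta, beta, mul_comm, add_comm]

theorem beta_add_one_right (ha : 0 < a) (hb : 0 < b) :
    beta a (b + 1) = beta a b * (b / (a + b)) := by
  rw [beta_symm, beta_add_one_left hb ha, beta_symm, add_comm]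

theorem lintegral_beta (ha : 0 < a) (hb : 0 < b) :
    ∫⁻ x in Set.Ioo (0 : ℝ) 1, ENNReal.ofReal (x ^ (a - 1) * (1 - x) ^ (b - 1)) =
      ENNReal.ofReal (beta a b) := by
  have hB := beta_pos ha hb
  have hpdf : ∀ x : ℝ, ENNReal.ofReal (x ^ (a - 1) * (1 - x) ^ (b - 1)) =
      ENNReal.ofReal (beta a b) *
        ENNReal.ofReal (1 / beta a b * x ^ (a - 1) * (1 - x) ^ (b - 1)) := by
    intro x
    rw [← ENNReal.ofReal_mul hB.le]
    congr 1
    field_simp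
  simp_rw [hpdf]
  rw [lintegral_const_mul _ (by fun_prop), ← lintegral_betaPDF, lintegral_betaPDF_eq_one ha hb,
    mul_one]

theorem rpow_mul_one_sub_rpow_pos (a b : ℝ) {x : ℝ} (hx : x ∈ Set.Ioo (0 : ℝ) 1) :
    0 < x ^ a * (1 - x) ^ b :=
  mul_pos (Real.rpow_pos_of_pos hx.1 _) (Real.rpow_pos_of_pos (sub_pos.2 hx.2) _)

theorem ae_rpow_mul_one_sub_rpow_nonneg (a b : ℝ) :
    0 ≤ᵐ[volume.restrict (Set.Ioo (0 : ℝ) 1)] fun x => x ^ a * (1 - x) ^ b :=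
  ae_restrict_of_forall_mem measurableSet_Ioo fun _ hx => (rpow_mul_one_sub_rpow_pos a b hx).le

theorem integrableOn_beta (ha : 0 < a) (hb : 0 < b) :
    IntegrableOn (fun x : ℝ => x ^ (a - 1) * (1 - x) ^ (b - 1)) (Set.Ioo 0 1) := by
  refine ⟨Measurable.aestronglyMeasurable (by fun_prop), ?_⟩
  rw [hasFiniteIntegral_iff_ofReal (ae_rpow_mul_one_sub_rpow_nonneg _ _), lintegral_beta ha hb]
  exact ENNReal.ofReal_lt_top

theorem integral_beta (ha : 0 < a) (hb : 0 < b) :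
    ∫ x in Set.Ioo (0 : ℝ) 1, x ^ (a - 1) * (1 - x) ^ (b - 1) = beta a b := by
  rw [integral_eq_lintegral_of_nonneg_ae (ae_rpow_mul_one_sub_rpow_nonneg _ _)
    (Measurable.aestronglyMeasurable (by fun_prop)), lintegral_beta ha hb,
    ENNReal.toReal_ofReal (beta_pos ha hb).le]

end BetaIntegral

section Mass

/-- The total integral of `h(a,b,p,q,r;x)` over `(0,1)`, the normalizing constant of
`BH(a,b,p,q,r)`. -/
def mass (a b p q r : ℝ) : ℝ := ∫ x in Set.Ioo (0 : ℝ) 1, h a b p q r x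

variable {a b p q r : ℝ}

theorem hgCoeff_mul_beta_raabe {δ : ℝ} (ha : 0 < a) (hb : 0 < b) (hδ : δ < r + b - p - q) :
    ∀ᶠ n : ℕ in atTop, (n + 1) * (|hgCoeff p q r (n + 1)| * beta (a + (n + 1 : ℕ)) b) ≤
      (n - δ) * (|hgCoeff p q r n| * beta (a + n) b) := by
  filter_upwards [eventually_natCast_add_pos p, eventually_natCast_add_pos q,
    eventually_natCast_add_pos r, eventually_mul_mul_le p q a r (a + b) (δ := δ) (by linarith)]
    with n hp hq hr hle
  have han : 0 < a + n := by positivity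
  have hB : 0 < beta (a + n) b := beta_pos han hb
  have hcoeff : (n + 1) * |hgCoeff p q r (n + 1)| =
      (p + n) * (q + n) / (r + n) * |hgCoeff p q r n| := by
    have := congrArg abs (hgCoeff_succ p q (r := r) (n := n) fun h => hr.ne' (by simp [h]))
    rw [abs_mul, abs_of_pos (by positivity), abs_mul, abs_of_pos (mul_pos hp hq)] at this
    rw [div_mul_eq_mul_div, eq_div_iff hr.ne']
    linarith
  have hratio : (p + n) * (q + n) / (r + n) * ((a + n) / (a + b + n)) ≤ n - δ := by
    rwa [div_mul_div_comm, div_le_iff₀ (by positivity)]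
  rw [Nat.cast_succ, ← add_assoc a, beta_add_one_left han hb, add_right_comm a]
  calc (n + 1) * (|hgCoeff p q r (n + 1)| * (beta (a + n) b * ((a + n) / (a + b + n))))
      = ((n + 1) * |hgCoeff p q r (n + 1)|) * ((a + n) / (a + b + n)) * beta (a + n) b := by ring
    _ = (p + n) * (q + n) / (r + n) * ((a + n) / (a + b + n)) *
          (|hgCoeff p q r n| * beta (a + n) b) := by rw [hcoeff]; ring
    _ ≤ (n - δ) * (|hgCoeff p q r n| * beta (a + n) b) := by gcongr

theorem hgCoeff_mul_beta_nonneg (ha : 0 < a) (hb : 0 < b) (n : ℕ) :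
    0 ≤ |hgCoeff p q r n| * beta (a + n) b :=
  mul_nonneg (abs_nonneg _) (beta_pos (by positivity) hb).le

theorem summable_hgCoeff_mul_beta (ha : 0 < a) (hb : 0 < b) (hs : 0 < r + b - p - q) :
    Summable fun n : ℕ => |hgCoeff p q r n| * beta (a + n) b :=
  summable_of_raabe (hgCoeff_mul_beta_nonneg ha hb) (half_pos hs)
    (hgCoeff_mul_beta_raabe ha hb (half_lt_self hs))

theorem tendsto_natCast_mul_hgCoeff_mul_beta (ha : 0 < a) (hb : 0 < b)
    (hs : 0 < r + b - p - q) :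
    Tendsto (fun n : ℕ => n * (hgCoeff p q r n * beta (a + n) b)) atTop (𝓝 0) := by
  refine squeeze_zero_norm (fun n => le_of_eq ?_) (tendsto_natCast_mul_of_raabe
    (hgCoeff_mul_beta_nonneg ha hb) (half_pos hs) (hgCoeff_mul_beta_raabe ha hb (half_lt_self hs)))
  rw [norm_mul, norm_mul, Real.norm_of_nonneg (n.cast_nonneg), Real.norm_eq_abs,
    Real.norm_of_nonneg (beta_pos (by positivity) hb).le]

theorem hasSum_h {x : ℝ} (hx : x ∈ Set.Ioo (0 : ℝ) 1) :
    HasSum (fun n : ℕ => hgCoeff p q r n * (x ^ (a + n - 1) * (1 - x) ^ (b - 1)))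
      (h a b p q r x) := by
  have hx' : ‖x‖ < 1 := by rw [Real.norm_of_nonneg hx.1.le]; exact hx.2
  refine ((hasSum_ordinaryHypergeometric p q r hx').mul_left _).congr_fun fun n => ?_
  rw [add_sub_right_comm, Real.rpow_add hx.1, Real.rpow_natCast]
  ring

theorem integral_norm_hgCoeff_mul (ha : 0 < a) (hb : 0 < b) (n : ℕ) :
    ∫ x in Set.Ioo (0 : ℝ) 1, ‖hgCoeff p q r n * (x ^ (a + n - 1) * (1 - x) ^ (b - 1))‖ =
      |hgCoeff p q r n| * beta (a + n) b := by
  rw [← integral_beta (by positivity) hb, ← integral_const_mul]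
  refine setIntegral_congr_fun measurableSet_Ioo fun x hx => ?_
  rw [norm_mul, Real.norm_of_nonneg (rpow_mul_one_sub_rpow_pos _ _ hx).le, Real.norm_eq_abs]

theorem hasSum_mass (ha : 0 < a) (hb : 0 < b) (hs : 0 < r + b - p - q) :
    HasSum (fun n : ℕ => hgCoeff p q r n * beta (a + n) b) (mass a b p q r) := by
  have hsum := hasSum_integral_of_summable_integral_norm
    (μ := volume.restrict (Set.Ioo (0 : ℝ) 1))
    (F := fun (n : ℕ) (x : ℝ) => hgCoeff p q r n * (x ^ (a + n - 1) * (1 - x) ^ (b - 1)))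
    (fun n => (integrableOn_beta (by positivity) hb).const_mul _)
    (by simpa only [integral_norm_hgCoeff_mul ha hb] using summable_hgCoeff_mul_beta ha hb hs)
  rw [setIntegral_congr_fun measurableSet_Ioo fun x hx => (hasSum_h hx).tsum_eq] at hsum
  refine hsum.congr_fun fun n => ?_
  rw [integral_const_mul, integral_beta (by positivity) hb]

theorem measurable_h (a b p q r : ℝ) : Measurable (h a b p q r) := by
  have := measurable_ordinaryHypergeometric p q r
  unfold h
  fun_prop

theorem integrableOn_h (ha : 0 < a) (hb : 0 < b) (hs : 0 < r + b - p - q) :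
    IntegrableOn (h a b p q r) (Set.Ioo 0 1) := by
  refine ⟨(measurable_h a b p q r).aestronglyMeasurable, ?_⟩
  have hterm : ∀ n : ℕ, ∫⁻ x in Set.Ioo (0 : ℝ) 1,
      ‖hgCoeff p q r n * (x ^ (a + n - 1) * (1 - x) ^ (b - 1))‖ₑ =
        ENNReal.ofReal (|hgCoeff p q r n| * beta (a + n) b) := fun n => by
    rw [← integral_norm_hgCoeff_mul ha hb, ofReal_integral_norm_eq_lintegral_enorm]
    exact (integrableOn_beta (by positivity) hb).const_mul _
  calc ∫⁻ x in Set.Ioo (0 : ℝ) 1, ‖h a b p q r x‖ₑ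
      ≤ ∫⁻ x in Set.Ioo (0 : ℝ) 1,
          ∑' n : ℕ, ‖hgCoeff p q r n * (x ^ (a + n - 1) * (1 - x) ^ (b - 1))‖ₑ :=
        setLIntegral_mono' measurableSet_Ioo fun x hx => by
          rw [← (hasSum_h hx).tsum_eq]
          exact enorm_tsum_le_tsum_enorm
    _ = ∑' n : ℕ, ENNReal.ofReal (|hgCoeff p q r n| * beta (a + n) b) := by
        rw [lintegral_tsum fun n => Measurable.aemeasurable (by fun_prop)]
        simp_rw [hterm]
    _ < ⊤ := (summable_hgCoeff_mul_beta ha hb hs).tsum_ofReal_lt_top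

theorem ne_neg_natCast_of_pos (hr : 0 < r) (n : ℕ) : r ≠ -(n : ℝ) :=
  ((neg_nonpos.2 n.cast_nonneg).trans_lt hr).ne'

theorem sum_range_hgCoeff_mul_beta (p q : ℝ) (hr : 0 < r) (hb : 0 < b) (N : ℕ) :
    ∑ n ∈ Finset.range N, ((r + b - p) * (r + b - q) * (hgCoeff p q r n * beta (r + n) (b + 1)) -
      b * (r + b - p - q) * (hgCoeff p q r n * beta (r + n) b)) =
      b * (N * (hgCoeff p q r N * beta (r + N) b)) := by
  induction N with
  | zero => simp
  | succ n ih =>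
    have hn : 0 < r + n := by positivity
    have hnb : r + n + b ≠ 0 := by positivity
    have hrec := hgCoeff_succ p q (ne_neg_natCast_of_pos hr n)
    rw [Finset.sum_range_succ, ih, Nat.cast_succ, ← add_assoc r, beta_add_one_left hn hb,
      beta_add_one_right hn hb]
    field_simp
    linear_combination -beta (r + n) b * hrec

theorem mass_add_one (hr : 0 < r) (hb : 0 < b) (hs : 0 < r + b - p - q) :
    (r + b - p) * (r + b - q) * mass r (b + 1) p q r = b * (r + b - p - q) * mass r b p q r := by
  have hs₁ : 0 < r + (b + 1) - p - q := by linarith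
  have hsum := ((hasSum_mass hr (by linarith) hs₁).mul_left ((r + b - p) * (r + b - q))).sub
    ((hasSum_mass hr hb hs).mul_left (b * (r + b - p - q)))
  have hlim := hsum.tendsto_sum_nat
  simp_rw [sum_range_hgCoeff_mul_beta p q hr hb] at hlim
  have hzero := (tendsto_natCast_mul_hgCoeff_mul_beta hr hb hs).const_mul b
  linarith [tendsto_nhds_unique hlim hzero]

end Mass

section PositiveMass

variable {a b p q r : ℝ}

theorem h_pos (hF : ∀ x ∈ Set.Ioo (0 : ℝ) 1, 0 < ₂F₁ p q r x) (a b : ℝ) {x : ℝ}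
    (hx : x ∈ Set.Ioo (0 : ℝ) 1) : 0 < h a b p q r x :=
  mul_pos (rpow_mul_one_sub_rpow_pos _ _ hx) (hF x hx)

theorem mass_pos (hF : ∀ x ∈ Set.Ioo (0 : ℝ) 1, 0 < ₂F₁ p q r x) (ha : 0 < a) (hb : 0 < b)
    (hs : 0 < r + b - p - q) : 0 < mass a b p q r := by
  rw [mass, setIntegral_pos_iff_support_of_nonneg_ae (ae_restrict_of_forall_mem measurableSet_Ioo
    fun _ hx => (h_pos hF _ _ hx).le) (integrableOn_h ha hb hs)]
  have hsupp : Set.Ioo (0 : ℝ) 1 ⊆ Function.support (h a b p q r) ∩ Set.Ioo 0 1 :=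
    fun x hx => ⟨(h_pos hF _ _ hx).ne', hx⟩
  exact lt_of_lt_of_le (by simp) (measure_mono hsupp)

theorem lintegral_h (hF : ∀ x ∈ Set.Ioo (0 : ℝ) 1, 0 < ₂F₁ p q r x) (ha : 0 < a) (hb : 0 < b)
    (hs : 0 < r + b - p - q) :
    ∫⁻ x in Set.Ioo (0 : ℝ) 1, ENNReal.ofReal (h a b p q r x) = ENNReal.ofReal (mass a b p q r) :=
  (ofReal_integral_eq_lintegral_ofReal (integrableOn_h ha hb hs)
    (ae_restrict_of_forall_mem measurableSet_Ioo fun _ hx => (h_pos hF _ _ hx).le)).symm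

theorem isProbabilityMeasure_BH (hadm : Admissible a b p q r) :
    IsProbabilityMeasure (BH a b p q r) := by
  obtain ⟨-, hF, ha, hb, hs⟩ := hadm
  constructor
  rw [BH, Measure.smul_apply, smul_eq_mul, unnormalizedBH, withDensity_apply _ MeasurableSet.univ,
    Measure.restrict_univ, lintegral_h hF ha hb hs]
  exact ENNReal.inv_mul_cancel (ENNReal.ofReal_pos.2 (mass_pos hF ha hb hs)).ne'
    ENNReal.ofReal_ne_top

theorem ae_mem_Ioo_BH (a b p q r : ℝ) : ∀ᵐ x ∂BH a b p q r, x ∈ Set.Ioo (0 : ℝ) 1 :=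
  Measure.ae_smul_measure
    ((withDensity_absolutelyContinuous _ _).ae_le (ae_restrict_mem measurableSet_Ioo)) _

theorem sub_pos_of_hypergeometric_pos (hF : ∀ x ∈ Set.Ioo (0 : ℝ) 1, 0 < ₂F₁ p q r x)
    (hr : 0 < r) (hb : 0 < b) (hs : 0 < r + b - p - q) (hq : 0 < r + b - q) : 0 < r + b - p := by
  have hmass : 0 < (r + b - p) * (r + b - q) * mass r (b + 1) p q r := by
    rw [mass_add_one hr hb hs]
    exact mul_pos (mul_pos hb hs) (mass_pos hF hr hb hs)
  have hmass' : 0 < mass r (b + 1) p q r := mass_pos hF hr (by linarith) (by linarith)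
  exact pos_of_mul_pos_left (pos_of_mul_pos_left hmass hmass'.le) hq.le

theorem hgCoeff_one_one_nonneg {s : ℝ} (hs : 0 < s) (n : ℕ) : 0 ≤ hgCoeff s 1 1 n := by
  rw [hgCoeff_one_one]
  exact mul_nonneg (by positivity) (ascPochhammer_pos n s hs).le

theorem hgCoeff_mul_mass (hF : ∀ x ∈ Set.Ioo (0 : ℝ) 1, 0 < ₂F₁ p q r x)
    (hr : 0 < r) (hb : 0 < b) (hs : 0 < r + b - p - q) (hq : 0 < r + b - q) (n : ℕ) :
    hgCoeff (r + b - q) 1 1 n * mass r (b + n) p q r =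
      mass r b p q r * hgCoeff b (r + b - p - q) (r + b - p) n := by
  have hM := (mass_pos hF hr hb hs).ne'
  have hp := sub_pos_of_hypergeometric_pos hF hr hb hs hq
  have key : (fun n : ℕ => hgCoeff (r + b - q) 1 1 n * mass r (b + n) p q r / mass r b p q r) =
      hgCoeff b (r + b - p - q) (r + b - p) := by
    refine eq_hgCoeff_of_recurrence (ne_neg_natCast_of_pos hp) (by simp [hgCoeff_zero, hM])
      fun n => ?_
    have hmass := mass_add_one (p := p) (q := q) (b := b + n) hr (by positivity)
      (by linarith [n.cast_nonneg (α := ℝ)])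
    rw [Nat.cast_succ, ← add_assoc b]
    field_simp
    linear_combination
      (r + b - p + n) * mass r (b + n + 1) p q r * hgCoeff_one_one_succ (r + b - q) n +
        hgCoeff (r + b - q) 1 1 n * hmass
  rw [← key]
  field_simp

theorem hasSum_h_mul_rpow (a b p q r s : ℝ) {x y : ℝ} (hx : x ∈ Set.Ioo (0 : ℝ) 1)
    (hy : y ∈ Set.Ioo (0 : ℝ) 1) :
    HasSum (fun n : ℕ => hgCoeff s 1 1 n * y ^ n * h a (b + n) p q r x)
      (h a b p q r x * (1 - y * (1 - x)) ^ (-s)) := by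
  have hx1 : 0 < 1 - x := sub_pos.2 hx.2
  have habs : |y * (1 - x)| < 1 := by
    rw [abs_of_pos (mul_pos hy.1 hx1)]
    exact mul_lt_one_of_nonneg_of_lt_one_left hy.1.le hy.2 (by linarith [hx.1])
  rw [← ordinaryHypergeometric_one_one s habs]
  refine ((hasSum_ordinaryHypergeometric s 1 1 habs).mul_left _).congr_fun fun n => ?_
  rw [h, h, add_sub_right_comm, Real.rpow_add hx1, Real.rpow_natCast, mul_pow]
  ring

theorem lintegral_h_mul_rpow (hF : ∀ x ∈ Set.Ioo (0 : ℝ) 1, 0 < ₂F₁ p q r x) (ha : 0 < a)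
    (hb : 0 < b) (hs : 0 < r + b - p - q) {s y : ℝ} (hs' : 0 < s) (hy : y ∈ Set.Ioo (0 : ℝ) 1) :
    ∫⁻ x in Set.Ioo (0 : ℝ) 1, ENNReal.ofReal (h a b p q r x * (1 - y * (1 - x)) ^ (-s)) =
      ∑' n : ℕ, ENNReal.ofReal (hgCoeff s 1 1 n * y ^ n * mass a (b + n) p q r) := by
  have hc : ∀ n : ℕ, 0 ≤ hgCoeff s 1 1 n * y ^ n := fun n =>
    mul_nonneg (hgCoeff_one_one_nonneg hs' n) (pow_nonneg hy.1.le n)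
  have hexpand : ∀ x ∈ Set.Ioo (0 : ℝ) 1,
      ENNReal.ofReal (h a b p q r x * (1 - y * (1 - x)) ^ (-s)) =
        ∑' n : ℕ, ENNReal.ofReal (hgCoeff s 1 1 n * y ^ n) *
          ENNReal.ofReal (h a (b + n) p q r x) := by
    intro x hx
    have hsum := hasSum_h_mul_rpow a b p q r s hx hy
    rw [← hsum.tsum_eq, ENNReal.ofReal_tsum_of_nonneg
      (fun n => mul_nonneg (hc n) (h_pos hF _ _ hx).le) hsum.summable]
    exact tsum_congr fun n => ENNReal.ofReal_mul (hc n)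
  rw [setLIntegral_congr_fun measurableSet_Ioo hexpand, lintegral_tsum fun n =>
    ((measurable_h _ _ _ _ _).ennreal_ofReal.const_mul _).aemeasurable]
  refine tsum_congr fun n => ?_
  rw [lintegral_const_mul _ (measurable_h _ _ _ _ _).ennreal_ofReal,
    lintegral_h hF ha (by positivity) (by linarith [n.cast_nonneg (α := ℝ)]),
    ENNReal.ofReal_mul (hc n)]

theorem lintegral_h_mul_rpow_eq_hypergeometric (hF : ∀ x ∈ Set.Ioo (0 : ℝ) 1, 0 < ₂F₁ p q r x)
    (hr : 0 < r) (hb : 0 < b) (hs : 0 < r + b - p - q) (hq : 0 < r + b - q) {y : ℝ}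
    (hy : y ∈ Set.Ioo (0 : ℝ) 1) :
    ∫⁻ x in Set.Ioo (0 : ℝ) 1,
        ENNReal.ofReal (h r b p q r x * (1 - y * (1 - x)) ^ (-(r + b - q))) =
      ENNReal.ofReal (mass r b p q r * ₂F₁ b (r + b - p - q) (r + b - p) y) := by
  have hy' : ‖y‖ < 1 := by rw [Real.norm_of_nonneg hy.1.le]; exact hy.2
  have hsum : HasSum (fun n : ℕ => hgCoeff (r + b - q) 1 1 n * y ^ n * mass r (b + n) p q r)
      (mass r b p q r * ₂F₁ b (r + b - p - q) (r + b - p) y) := by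
    refine ((hasSum_ordinaryHypergeometric _ _ _ hy').mul_left _).congr_fun fun n => ?_
    rw [mul_right_comm, hgCoeff_mul_mass hF hr hb hs hq, mul_assoc]
  have hnonneg : ∀ n : ℕ, 0 ≤ hgCoeff (r + b - q) 1 1 n * y ^ n * mass r (b + n) p q r :=
    fun n => mul_nonneg (mul_nonneg (hgCoeff_one_one_nonneg hq n) (pow_nonneg hy.1.le n))
      (mass_pos hF hr (by positivity) (by linarith [n.cast_nonneg (α := ℝ)])).le
  rw [lintegral_h_mul_rpow hF hr hb hs hq hy, ← hsum.tsum_eq,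
    ENNReal.ofReal_tsum_of_nonneg hnonneg hsum.summable]

end PositiveMass

/-! ### Moebius transforms of beta hypergeometric variables -/

section Step

variable {a b p q r c d : ℝ}

theorem measurable_moebius : Measurable fun z : ℝ × ℝ => moebius z.1 z.2 := by
  unfold moebius
  fun_prop

theorem hasDerivAt_moebius {w x : ℝ} (hw : 1 + w * x ≠ 0) :
    HasDerivAt (fun w => moebius w x) (-(x * moebius w x ^ 2)) w := by
  simp only [moebius, one_div]
  refine (((hasDerivAt_mul_const x).const_add 1).fun_inv hw).congr_deriv ?_
  rw [inv_pow, neg_div, div_eq_mul_inv]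

theorem injective_moebius_left {x : ℝ} (hx : x ≠ 0) : Function.Injective fun w => moebius w x := by
  intro w w' hww'
  simpa [moebius, hx] using hww'

theorem image_moebius_Ioi {x : ℝ} (hx : 0 < x) :
    (fun w => moebius w x) '' Set.Ioi 0 = Set.Ioo 0 1 := by
  ext y
  constructor
  · rintro ⟨w, hw, rfl⟩
    have hwx : 0 < w * x := mul_pos hw hx
    exact ⟨one_div_pos.2 (by linarith), (div_lt_one (by linarith)).2 (by linarith)⟩
  · intro hy
    refine ⟨(1 / y - 1) / x, div_pos (sub_pos.2 ((one_lt_div hy.1).2 hy.2)) hx, ?_⟩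
    simp only [moebius, div_mul_cancel₀ _ hx.ne', add_sub_cancel, one_div_one_div]

theorem density_moebius_mul_deriv (c d : ℝ) {w x y : ℝ} (hw : 0 < w) (hx : 0 < x)
    (hy : y = moebius w x) :
    x * y ^ 2 * (y ^ (d - 1) * (1 - y) ^ (c - 1) * (x ^ d * (1 - y * (1 - x)) ^ (-(c + d)))) =
      w ^ (c - 1) / (1 + w) ^ (c + d) := by
  have hden : 0 < 1 + w * x := by positivity
  have hy0 : 0 < y := hy ▸ one_div_pos.2 hden
  have hyden : y * (1 + w * x) = 1 := by rw [hy, moebius, one_div_mul_cancel hden.ne']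
  have hone_sub : 1 - y = w * (x * y) := by linear_combination -hyden
  have hone_sub' : 1 - y * (1 - x) = (1 + w) * (x * y) := by linear_combination -hyden
  have hxy : 0 < x * y := mul_pos hx hy0
  rw [hone_sub, hone_sub', Real.rpow_neg (by positivity), Real.mul_rpow hw.le hxy.le,
    Real.mul_rpow (by positivity : 0 ≤ 1 + w) hxy.le, Real.rpow_add hxy, Real.rpow_sub_one hxy.ne',
    Real.rpow_sub_one hy0.ne', Real.mul_rpow (z := d) hx.le hy0.le]
  field_simp

theorem lintegral_betaPrimePDF_mul_comp_moebius (hc : 0 < c) (hd : 0 < d) {x : ℝ} (hx : 0 < x)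
    (φ : ℝ → ENNReal) :
    ∫⁻ w in Set.Ioi (0 : ℝ), ENNReal.ofReal
        (1 / beta c d * (w ^ (c - 1) / (1 + w) ^ (c + d))) * φ (moebius w x) =
      ∫⁻ y in Set.Ioo (0 : ℝ) 1, ENNReal.ofReal (1 / beta c d *
        (y ^ (d - 1) * (1 - y) ^ (c - 1) * (x ^ d * (1 - y * (1 - x)) ^ (-(c + d))))) * φ y := by
  have := beta_pos hc hd
  have hden : ∀ w ∈ Set.Ioi (0 : ℝ), 0 < 1 + w * x := fun w hw =>
    add_pos one_pos (mul_pos hw hx)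
  rw [← image_moebius_Ioi hx, lintegral_image_eq_lintegral_abs_deriv_mul measurableSet_Ioi
    (fun w hw => (hasDerivAt_moebius (hden w hw).ne').hasDerivWithinAt)
    (injective_moebius_left hx.ne').injOn]
  refine setLIntegral_congr_fun measurableSet_Ioi fun w hw => ?_
  rw [← density_moebius_mul_deriv c d hw hx rfl, abs_neg, abs_of_nonneg (by positivity),
    ← mul_assoc (ENNReal.ofReal _), ← ENNReal.ofReal_mul (by positivity)]
  congr 2
  ring

theorem lintegral_betaPrime (c d : ℝ) {φ : ℝ → ENNReal} (hφ : Measurable φ) :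
    ∫⁻ w, φ w ∂betaPrime c d = ∫⁻ w in Set.Ioi (0 : ℝ), ENNReal.ofReal
      (1 / beta c d * (w ^ (c - 1) / (1 + w) ^ (c + d))) * φ w := by
  rw [betaPrime, lintegral_withDensity_eq_lintegral_mul _ (by fun_prop) hφ]
  rfl

theorem isProbabilityMeasure_betaPrime (hc : 0 < c) (hd : 0 < d) :
    IsProbabilityMeasure (betaPrime c d) := by
  have hB := beta_pos hc hd
  constructor
  have hbeta := (lintegral_betaPrime c d measurable_const).trans
    (lintegral_betaPrimePDF_mul_comp_moebius hc hd one_pos fun _ => 1)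
  simp only [sub_self, mul_zero, sub_zero, Real.one_rpow, mul_one,
    ENNReal.ofReal_mul (one_div_pos.2 hB).le] at hbeta
  rw [← lintegral_one, hbeta, lintegral_const_mul _ (by fun_prop), lintegral_beta hd hc,
    beta_symm d c, ← ENNReal.ofReal_mul (one_div_pos.2 hB).le, one_div_mul_cancel hB.ne',
    ENNReal.ofReal_one]

instance (a b p q r : ℝ) : SFinite (unnormalizedBH a b p q r) := by
  unfold unnormalizedBH
  infer_instance

theorem lintegral_unnormalizedBH (a b p q r : ℝ) {φ : ℝ → ENNReal} (hφ : Measurable φ) :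
    ∫⁻ x, φ x ∂unnormalizedBH a b p q r =
      ∫⁻ x in Set.Ioo (0 : ℝ) 1, ENNReal.ofReal (h a b p q r x) * φ x := by
  rw [unnormalizedBH, lintegral_withDensity_eq_lintegral_mul _
    (measurable_h a b p q r).ennreal_ofReal hφ]
  rfl

theorem ofReal_h_mul_lintegral_moebius (hF : ∀ x ∈ Set.Ioo (0 : ℝ) 1, 0 < ₂F₁ p q r x)
    (hc : 0 < c) (hd : 0 < d) (hr : r = a + d) {φ : ℝ → ENNReal} (hφ : Measurable φ) {x : ℝ}
    (hx : x ∈ Set.Ioo (0 : ℝ) 1) :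
    ENNReal.ofReal (h a b p q r x) * ∫⁻ w, φ (moebius w x) ∂betaPrime c d =
      ∫⁻ y in Set.Ioo (0 : ℝ) 1,
        ENNReal.ofReal (1 / beta c d * (y ^ (d - 1) * (1 - y) ^ (c - 1))) * φ y *
          ENNReal.ofReal (h r b p q r x * (1 - y * (1 - x)) ^ (-(c + d))) := by
  have hB := beta_pos hc hd
  have hφx : Measurable fun w => φ (moebius w x) :=
    hφ.comp (measurable_moebius.comp measurable_prodMk_right)
  have hh : h r b p q r x = h a b p q r x * x ^ d := by
    rw [h, h, hr, add_sub_right_comm, Real.rpow_add hx.1]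
    ring
  rw [lintegral_betaPrime c d hφx, lintegral_betaPrimePDF_mul_comp_moebius hc hd hx.1,
    ← lintegral_const_mul _ (by fun_prop)]
  refine setLIntegral_congr_fun measurableSet_Ioo fun y hy => ?_
  have hy' := rpow_mul_one_sub_rpow_pos (d - 1) (c - 1) hy
  rw [← mul_assoc, ← ENNReal.ofReal_mul (h_pos hF _ _ hx).le, mul_right_comm _ (φ y),
    ← ENNReal.ofReal_mul (by positivity), hh]
  congr 2
  ring

theorem lintegral_lintegral_moebius_unnormalizedBH (hadm : Admissible a b p q r) (hc : 0 < c)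
    (hd : 0 < d) (hr : r = a + d) (hq : r + b - q = c + d) {φ : ℝ → ENNReal} (hφ : Measurable φ) :
    ∫⁻ x, ∫⁻ w, φ (moebius w x) ∂betaPrime c d ∂unnormalizedBH a b p q r =
      ENNReal.ofReal (1 / beta c d * mass r b p q r) *
        ∫⁻ y, φ y ∂unnormalizedBH d c b (r + b - p - q) (r + b - p) := by
  obtain ⟨-, hF, ha, hb, hs⟩ := hadm
  have hr0 : 0 < r := hr ▸ add_pos ha hd
  have hq0 : 0 < r + b - q := hq ▸ add_pos hc hd
  have hB := beta_pos hc hd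
  have hM := mass_pos hF hr0 hb hs
  have hh := measurable_h r b p q r
  have hh' := measurable_h d c b (r + b - p - q) (r + b - p)
  have : IsProbabilityMeasure (betaPrime c d) := isProbabilityMeasure_betaPrime hc hd
  have hinner : Measurable fun x => ∫⁻ w, φ (moebius w x) ∂betaPrime c d :=
    Measurable.lintegral_prod_right' (f := fun z : ℝ × ℝ => φ (moebius z.2 z.1))
      (hφ.comp (measurable_moebius.comp measurable_swap))
  rw [lintegral_unnormalizedBH _ _ _ _ _ hinner, setLIntegral_congr_fun measurableSet_Ioo
    fun x hx => ofReal_h_mul_lintegral_moebius hF hc hd hr hφ hx,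
    lintegral_lintegral_swap (by fun_prop), lintegral_unnormalizedBH _ _ _ _ _ hφ,
    ← lintegral_const_mul _ (by fun_prop)]
  refine setLIntegral_congr_fun measurableSet_Ioo fun y hy => ?_
  have hy' := rpow_mul_one_sub_rpow_pos (d - 1) (c - 1) hy
  rw [lintegral_const_mul _ (by fun_prop), ← hq,
    lintegral_h_mul_rpow_eq_hypergeometric hF hr0 hb hs hq0 hy, mul_right_comm,
    ← ENNReal.ofReal_mul (by positivity), ← mul_assoc (ENNReal.ofReal (1 / beta c d * _)),
    ← ENNReal.ofReal_mul (by positivity)]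
  congr 2
  rw [h]
  ring

theorem map_moebius_unnormalizedBH (hadm : Admissible a b p q r) (hc : 0 < c) (hd : 0 < d)
    (hr : r = a + d) (hq : r + b - q = c + d) :
    ((betaPrime c d).prod (unnormalizedBH a b p q r)).map (fun z => moebius z.1 z.2) =
      ENNReal.ofReal (1 / beta c d * mass r b p q r) •
        unnormalizedBH d c b (r + b - p - q) (r + b - p) := by
  have : IsProbabilityMeasure (betaPrime c d) := isProbabilityMeasure_betaPrime hc hd
  refine Measure.ext_of_lintegral _ fun φ hφ => ?_
  rw [lintegral_map hφ measurable_moebius,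
    lintegral_prod_symm (fun z => φ (moebius z.1 z.2)) (hφ.comp measurable_moebius).aemeasurable,
    lintegral_smul_measure, smul_eq_mul]
  exact lintegral_lintegral_moebius_unnormalizedBH hadm hc hd hr hq hφ

theorem smul_eq_inv_univ_smul {α : Type*} {m : MeasurableSpace α} {μ : Measure α} {k : ENNReal}
    (hk : IsProbabilityMeasure (k • μ)) : k • μ = (μ Set.univ)⁻¹ • μ := by
  rw [ENNReal.eq_inv_of_mul_eq_one_left (b := μ Set.univ) hk.measure_univ]

theorem map_moebius_BH (hadm : Admissible a b p q r) (hc : 0 < c) (hd : 0 < d)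
    (hr : r = a + d) (hq : r + b - q = c + d) :
    ((betaPrime c d).prod (BH a b p q r)).map (fun z => moebius z.1 z.2) =
      BH d c b (r + b - p - q) (r + b - p) := by
  have : IsProbabilityMeasure (betaPrime c d) := isProbabilityMeasure_betaPrime hc hd
  have : IsProbabilityMeasure (BH a b p q r) := isProbabilityMeasure_BH hadm
  have hprob := Measure.isProbabilityMeasure_map (μ := (betaPrime c d).prod (BH a b p q r))
    measurable_moebius.aemeasurable
  have hmap : ((betaPrime c d).prod (BH a b p q r)).map (fun z => moebius z.1 z.2) =
      ((unnormalizedBH a b p q r Set.univ)⁻¹ * ENNReal.ofReal (1 / beta c d * mass r b p q r)) •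
        unnormalizedBH d c b (r + b - p - q) (r + b - p) := by
    rw [BH, Measure.prod_smul_right, Measure.map_smul,
      map_moebius_unnormalizedBH hadm hc hd hr hq, smul_smul]
  rw [hmap] at hprob ⊢
  exact smul_eq_inv_univ_smul hprob

end Step

/-! ### Dependence on the parameters -/

section Triple

variable {a b p q r : ℝ}

theorem BH_congr {a' b' p' q' r' : ℝ}
    (heq : ∀ x ∈ Set.Ioo (0 : ℝ) 1, h a b p q r x = h a' b' p' q' r' x) :
    BH a b p q r = BH a' b' p' q' r' := by
  have : unnormalizedBH a b p q r = unnormalizedBH a' b' p' q' r' :=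
    withDensity_congr_ae (ae_restrict_of_forall_mem measurableSet_Ioo fun x hx => by
      simp only [heq x hx])
  rw [BH, BH, this]

theorem Admissible.comm (hadm : Admissible a b p q r) : Admissible a b q p r := by
  obtain ⟨hr, hF, ha, hb, hs⟩ := hadm
  exact ⟨hr, fun x hx => ordinaryHypergeometric_symm p q r x ▸ hF x hx, ha, hb, by linarith⟩

theorem BH_comm (a b p q r : ℝ) : BH a b p q r = BH a b q p r :=
  BH_congr fun x _ => by rw [h, h, ordinaryHypergeometric_symm]

theorem ordinaryHypergeometric_euler_of_mem_Ioo (p q : ℝ) (hr : ∀ n : ℕ, r ≠ -(n : ℝ)) {x : ℝ}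
    (hx : x ∈ Set.Ioo (0 : ℝ) 1) :
    ₂F₁ p q r x = (1 - x) ^ (r - p - q) * ₂F₁ (r - p) (r - q) r x :=
  ordinaryHypergeometric_euler p q hr (abs_lt.2 ⟨by linarith [hx.1], hx.2⟩)

theorem Admissible.euler (hadm : Admissible a b p q r) :
    Admissible a (r + b - p - q) (r - p) (r - q) r := by
  obtain ⟨hr, hF, ha, hb, hs⟩ := hadm
  refine ⟨hr, fun x hx => ?_, ha, hs, by linarith⟩
  have hFx := hF x hx
  rw [ordinaryHypergeometric_euler_of_mem_Ioo p q hr hx] at hFx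
  exact pos_of_mul_pos_right hFx (Real.rpow_nonneg (sub_nonneg.2 hx.2.le) _)

theorem BH_euler (a b p q : ℝ) (hr : ∀ n : ℕ, r ≠ -(n : ℝ)) :
    BH a b p q r = BH a (r + b - p - q) (r - p) (r - q) r := by
  refine BH_congr fun x hx => ?_
  have hexp : r + b - p - q - 1 = b - 1 + (r - p - q) := by ring
  rw [h, h, ordinaryHypergeometric_euler_of_mem_Ioo p q hr hx, hexp,
    Real.rpow_add (sub_pos.2 hx.2)]
  ring

theorem ThetaAdmissible.congr_triple {θ θ' : Fin 5 → ℝ} (ht : triple θ = triple θ')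
    (hadm : ThetaAdmissible θ) : ThetaAdmissible θ' ∧ BHθ θ = BHθ θ' := by
  simp only [triple, Prod.mk.injEq, Sym2.eq_iff] at ht
  obtain ⟨e0, h12, h34⟩ := ht
  unfold ThetaAdmissible BHθ at *
  have hE := BH_euler (θ 3 + θ 4) (θ 0 + θ 2) (θ 2 + θ 4) (θ 2 + θ 3) hadm.1
  rcases h12 with ⟨e1, e2⟩ | ⟨e1, e2⟩ <;> rcases h34 with ⟨e3, e4⟩ | ⟨e3, e4⟩
  · rw [← e0, ← e1, ← e2, ← e3, ← e4]
    exact ⟨hadm, rfl⟩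
  · constructor
    · convert hadm.comm using 1 <;> linarith
    · rw [BH_comm]
      congr 1 <;> linarith
  · constructor
    · convert hadm.euler.comm using 1 <;> linarith
    · rw [hE, BH_comm]
      congr 1 <;> linarith
  · constructor
    · convert hadm.euler using 1 <;> linarith
    · rw [hE]
      congr 1 <;> linarith

end Triple

/-! ### Convergence of the continued fraction -/

section ContinuedFraction

theorem moebius_mem_Icc {w x : ℝ} (hw : 0 ≤ w) (hx : 0 ≤ x) :
    moebius w x ∈ Set.Icc (0 : ℝ) 1 := by
  have hwx : 0 ≤ w * x := mul_nonneg hw hx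
  exact ⟨one_div_nonneg.2 (by linarith), div_le_one_of_le₀ (by linarith) (by linarith)⟩

-- With respect to the relative distance `|x - y| / max x y`, the map `H_w` is a contraction with
-- factor `w / (1 + w) < 1`, whereas `|H_w'(0)| = w` can be large.
theorem abs_moebius_sub_moebius_le {w x y ρ : ℝ} (hw : 0 ≤ w) (hρ : 0 ≤ ρ)
    (hx : x ∈ Set.Icc (0 : ℝ) 1) (hy : y ∈ Set.Icc (0 : ℝ) 1) (h : |x - y| ≤ ρ * max x y) :
    |moebius w x - moebius w y| ≤ ρ * (w / (1 + w)) * max (moebius w x) (moebius w y) := by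
  wlog hxy : x ≤ y generalizing x y
  · rw [abs_sub_comm, max_comm]
    exact this hy hx (by rwa [abs_sub_comm, max_comm]) (le_of_not_ge hxy)
  have hwx : 0 ≤ w * x := mul_nonneg hw hx.1
  have hwy : 0 ≤ w * y := mul_nonneg hw hy.1
  have hle : moebius w y ≤ moebius w x :=
    one_div_le_one_div_of_le (by linarith) (by gcongr)
  have hfactor : w * y / (1 + w * y) ≤ w / (1 + w) := by
    rw [div_le_div_iff₀ (by positivity) (by positivity)]
    linarith [mul_le_mul_of_nonneg_left hy.2 hw]
  rw [max_eq_right hxy, abs_sub_comm, abs_of_nonneg (sub_nonneg.2 hxy)] at h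
  rw [abs_of_nonneg (sub_nonneg.2 hle), max_eq_left hle]
  calc moebius w x - moebius w y = w * (y - x) / (1 + w * y) * moebius w x := by
        unfold moebius
        field_simp
        ring
    _ ≤ w * (ρ * y) / (1 + w * y) * moebius w x := by
        have := (moebius_mem_Icc hw hx.1).1
        gcongr
    _ = ρ * (w * y / (1 + w * y)) * moebius w x := by ring
    _ ≤ ρ * (w / (1 + w)) * moebius w x := by
        have := (moebius_mem_Icc hw hx.1).1
        gcongr

theorem Z_add (w : ℕ → ℝ) (n m : ℕ) (x : ℝ) :
    Z w (n + m) x = Z w n (Z (fun k => w (n + k)) m x) := by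
  induction m generalizing x with
  | zero => rfl
  | succ m ih => exact ih _

theorem Z_mem_Icc {w : ℕ → ℝ} (hw : ∀ k, 0 ≤ w k) (n : ℕ) {x : ℝ} (hx : x ∈ Set.Icc (0 : ℝ) 1) :
    Z w n x ∈ Set.Icc (0 : ℝ) 1 := by
  induction n generalizing x with
  | zero => exact hx
  | succ n ih => exact ih (moebius_mem_Icc (hw n) hx.1)

/-- The product of the contraction factors of `H_{w 0}, …, H_{w (n-1)}` with respect to the
relative distance; it bounds the oscillation of `Z w n` on `[0,1]`. -/
def contractionFactor (w : ℕ → ℝ) (n : ℕ) : ℝ := ∏ k ∈ Finset.range n, w k / (1 + w k)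

theorem abs_Z_sub_Z_le_mul {w : ℕ → ℝ} (hw : ∀ k, 0 ≤ w k) (n : ℕ) {x y ρ : ℝ} (hρ : 0 ≤ ρ)
    (hx : x ∈ Set.Icc (0 : ℝ) 1) (hy : y ∈ Set.Icc (0 : ℝ) 1) (h : |x - y| ≤ ρ * max x y) :
    |Z w n x - Z w n y| ≤ ρ * contractionFactor w n := by
  induction n generalizing x y ρ with
  | zero =>
    rw [contractionFactor, Finset.prod_range_zero]
    exact h.trans (mul_le_mul_of_nonneg_left (max_le hx.2 hy.2) hρ)
  | succ n ih =>
    have hwn := hw n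
    have hstep := ih (by positivity) (moebius_mem_Icc hwn hx.1) (moebius_mem_Icc hwn hy.1)
      (abs_moebius_sub_moebius_le hwn hρ hx hy h)
    rwa [mul_assoc, mul_comm (w n / _), contractionFactor, ← Finset.prod_range_succ] at hstep

theorem abs_Z_sub_Z_le {w : ℕ → ℝ} (hw : ∀ k, 0 ≤ w k) (n : ℕ) {x y : ℝ}
    (hx : x ∈ Set.Icc (0 : ℝ) 1) (hy : y ∈ Set.Icc (0 : ℝ) 1) :
    |Z w n x - Z w n y| ≤ contractionFactor w n := by
  have hxy : |x - y| ≤ 1 * max x y := by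
    rw [one_mul, abs_sub_le_iff]
    exact ⟨by linarith [le_max_left x y, hy.1], by linarith [le_max_right x y, hx.1]⟩
  simpa only [one_mul] using abs_Z_sub_Z_le_mul hw n zero_le_one hx hy hxy

theorem tendsto_prod_range_zero {a : ℕ → ℝ} {c : ℝ} (ha₀ : ∀ k, 0 ≤ a k) (ha₁ : ∀ k, a k ≤ 1)
    (hc : c < 1) (hf : ∃ᶠ k in atTop, a k ≤ c) :
    Tendsto (fun n => ∏ k ∈ Finset.range n, a k) atTop (𝓝 0) := by
  set A : ℕ → ℝ := fun n => ∏ k ∈ Finset.range n, a k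
  have hA₀ : ∀ n, 0 ≤ A n := fun n => Finset.prod_nonneg fun k _ => ha₀ k
  have hsucc : ∀ n, A (n + 1) = A n * a n := fun n => Finset.prod_range_succ a n
  have hanti : Antitone A := antitone_nat_of_succ_le fun n =>
    (hsucc n).trans_le (mul_le_of_le_one_right (hA₀ n) (ha₁ n))
  have hlim := tendsto_atTop_ciInf hanti ⟨0, Set.forall_mem_range.2 hA₀⟩
  set L := ⨅ n, A n
  have hL₀ : 0 ≤ L := le_ciInf hA₀
  have hLc : L ≤ L * c :=
    le_of_tendsto_of_tendsto_of_frequently ((tendsto_add_atTop_iff_nat 1).2 hlim)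
      (hlim.mul_const c) (hf.mono fun n hn =>
        (hsucc n).trans_le (mul_le_mul_of_nonneg_left hn (hA₀ n)))
  have hL : L = 0 := by nlinarith
  rwa [hL] at hlim

theorem tendsto_contractionFactor {w : ℕ → ℝ} (hw : ∀ k, 0 ≤ w k)
    (hf : ∃ᶠ k in atTop, w k ≤ 1) : Tendsto (contractionFactor w) atTop (𝓝 0) := by
  have hpos : ∀ k, 0 < 1 + w k := fun k => by linarith [hw k]
  refine tendsto_prod_range_zero (c := 1 / 2) (fun k => div_nonneg (hw k) (hpos k).le)
    (fun k => (div_le_one (hpos k)).2 (by linarith)) (by norm_num) (hf.mono fun k hk => ?_)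
  rw [div_le_div_iff₀ (hpos k) two_pos]
  linarith

/-- The value of the continued fraction `1 / (1 + w 0 / (1 + w 1 / (1 + ⋯)))`, that is, the limit
of `Z w n 0`; an arbitrary number if this sequence diverges. -/
def contFrac (w : ℕ → ℝ) : ℝ := limUnder atTop fun n => Z w n 0

theorem tendsto_Z_zero {w : ℕ → ℝ} (hw : ∀ k, 0 ≤ w k) (hf : ∃ᶠ k in atTop, w k ≤ 1) :
    Tendsto (fun n => Z w n 0) atTop (𝓝 (contFrac w)) := by
  have h0 : (0 : ℝ) ∈ Set.Icc (0 : ℝ) 1 := Set.left_mem_Icc.2 zero_le_one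
  refine CauchySeq.tendsto_limUnder (cauchySeq_of_le_tendsto_0' (contractionFactor w)
    (fun n m hnm => ?_) (tendsto_contractionFactor hw hf))
  obtain ⟨k, rfl⟩ := Nat.exists_eq_add_of_le hnm
  rw [Z_add, Real.dist_eq]
  exact abs_Z_sub_Z_le hw n h0 (Z_mem_Icc (fun _ => hw _) _ h0)

theorem tendsto_Z {w x : ℕ → ℝ} (hw : ∀ k, 0 ≤ w k) (hf : ∃ᶠ k in atTop, w k ≤ 1)
    (hx : ∀ n, 0 ≤ x n) : Tendsto (fun n => Z w n (x n)) atTop (𝓝 (contFrac w)) := by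
  have hdiff : Tendsto (fun n => Z w (n + 1) (x (n + 1)) - Z w n 0) atTop (𝓝 0) :=
    squeeze_zero_norm (fun n => abs_Z_sub_Z_le hw n (moebius_mem_Icc (hw n) (hx _))
      (Set.left_mem_Icc.2 zero_le_one)) (tendsto_contractionFactor hw hf)
  rw [← tendsto_add_atTop_iff_nat 1]
  simpa only [sub_add_cancel, zero_add] using hdiff.add (tendsto_Z_zero hw hf)

end ContinuedFraction

/-! ### Random continued fractions -/

section RandomSequences

variable {α : Type*}

/-- The sequence with first term `z.1` followed by the sequence `z.2`. -/
def seqCons (z : α × (ℕ → α)) : ℕ → α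
  | 0 => z.1
  | n + 1 => z.2 n

theorem seqCons_preimage_pi_range (n : ℕ) (t : ℕ → Set α) :
    seqCons ⁻¹' Set.pi (Finset.range (n + 1)) t =
      t 0 ×ˢ Set.pi (Finset.range n) fun k => t (k + 1) := by
  ext z
  simp only [Set.mem_preimage, Set.mem_pi, Set.mem_prod, Finset.coe_range, Set.mem_Iio,
    Nat.forall_lt_succ_left, seqCons]

variable [MeasurableSpace α]

theorem measurable_seqCons : Measurable (seqCons : α × (ℕ → α) → ℕ → α) := by
  refine measurable_pi_iff.2 fun n => ?_
  cases n with
  | zero => exact measurable_fst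
  | succ n => exact (measurable_pi_apply n).comp measurable_snd

theorem ae_forall_infinitePi {β : ℕ → Measure α} [∀ n, IsProbabilityMeasure (β n)]
    {p : ℕ → α → Prop} (hp : ∀ n, ∀ᵐ x ∂β n, p n x) :
    ∀ᵐ w ∂Measure.infinitePi β, ∀ n, p n (w n) :=
  ae_all_iff.2 fun n => (measurePreserving_eval_infinitePi β n).quasiMeasurePreserving.ae (hp n)

theorem measurePreserving_seqCons (β : ℕ → Measure α) [∀ n, IsProbabilityMeasure (β n)] :
    MeasurePreserving seqCons ((β 0).prod (Measure.infinitePi fun n => β (n + 1)))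
      (Measure.infinitePi β) := by
  refine ⟨measurable_seqCons, Measure.eq_infinitePi β fun s t ht => ?_⟩
  -- A finite set of coordinates may be enlarged to an initial segment by adding trivial conditions.
  obtain ⟨n, hn⟩ := s.exists_nat_subset_range
  have hs : s ⊆ Finset.range (n + 1) := hn.trans (Finset.range_subset_range.2 n.le_succ)
  classical
  set u : ℕ → Set α := fun k => if k ∈ s then t k else Set.univ with hu
  have hum : ∀ k, MeasurableSet (u k) := fun k => by
    simp only [hu]
    split_ifs
    exacts [ht k, MeasurableSet.univ]
  have hpi : Set.pi s t = Set.pi (Finset.range (n + 1)) u := by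
    ext w
    refine ⟨fun hw k _ => ?_, fun hw k hk => ?_⟩
    · by_cases hk : k ∈ s <;> simp [hu, hk, hw k]
    · simpa [hu, Finset.mem_coe.1 hk] using hw k (hs hk)
  have hprod : ∏ k ∈ s, β k (t k) = ∏ k ∈ Finset.range (n + 1), β k (u k) := by
    rw [← Finset.prod_subset hs fun k _ hk => by simp [hu, hk]]
    exact Finset.prod_congr rfl fun k hk => by simp [hu, hk]
  rw [hpi, hprod, Measure.map_apply measurable_seqCons
    (MeasurableSet.pi (Finset.countable_toSet _) fun k _ => hum k), seqCons_preimage_pi_range,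
    Measure.prod_prod, Measure.infinitePi_pi _ fun k _ => hum (k + 1), Finset.prod_range_succ',
    mul_comm]

theorem hasLaw_of_ae_tendsto {E Ω : Type*} [MeasurableSpace E] [TopologicalSpace E]
    [TopologicalSpace.PseudoMetrizableSpace E] [BorelSpace E] [MeasurableSpace Ω]
    {P : Measure Ω} [IsProbabilityMeasure P] {μ : Measure E} {X : ℕ → Ω → E} {Y : Ω → E}
    (hX : ∀ n, HasLaw (X n) μ P) (hlim : ∀ᵐ ω ∂P, Tendsto (fun n => X n ω) atTop (𝓝 (Y ω))) :
    HasLaw Y μ P := by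
  have hY : AEMeasurable Y P :=
    aemeasurable_of_tendsto_metrizable_ae atTop (fun n => (hX n).aemeasurable) hlim
  refine ⟨hY, ?_⟩
  rw [← (hX 0).map_eq]
  exact tendstoInDistribution_unique X
    (tendstoInDistribution_of_ae_tendsto (fun n => (hX n).aemeasurable) hY hlim)
    (tendstoInDistribution_of_identDistrib 0 (fun n => (hX 0).identDistrib (hX n))
      ((hX 0).identDistrib (hX 0)))

theorem ae_frequently_mem_infinitePi {β : ℕ → Measure α} [∀ n, IsProbabilityMeasure (β n)]
    {s : Set α} (hs : MeasurableSet s) (hsum : ∑' n, β n s = ⊤) :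
    ∀ᵐ w ∂Measure.infinitePi β, ∃ᶠ k in atTop, w k ∈ s := by
  have hm : ∀ k, MeasurableSet {w : ℕ → α | w k ∈ s} := fun k => measurable_pi_apply k hs
  have hβ : ∀ k, Measure.infinitePi β {w | w k ∈ s} = β k s := fun k =>
    (measurePreserving_eval_infinitePi β k).measure_preimage hs.nullMeasurableSet
  have hind : iIndepSet (fun k => {w : ℕ → α | w k ∈ s}) (Measure.infinitePi β) := by
    rw [iIndepSet_iff_meas_biInter hm]
    intro S
    have hcoord : iIndepFun (fun k (w : ℕ → α) => w k) (Measure.infinitePi β) :=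
      iIndepFun_infinitePi (X := fun _ x => x) fun _ => measurable_id
    exact hcoord.measure_inter_preimage_eq_mul S (sets := fun _ => s) fun _ _ => hs
  have hlimsup : Measure.infinitePi β (limsup (fun k => {w : ℕ → α | w k ∈ s}) atTop) = 1 :=
    measure_limsup_eq_one hm hind (by simpa only [hβ] using hsum)
  filter_upwards [(mem_ae_iff_prob_eq_one (MeasurableSet.measurableSet_limsup hm)).2 hlimsup]
    with w hw
  exact mem_limsup_iff_frequently_mem.1 hw

end RandomSequences

section RandomContinuedFraction

theorem measurable_Z (n : ℕ) : Measurable fun z : (ℕ → ℝ) × ℝ => Z z.1 n z.2 := by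
  induction n with
  | zero => exact measurable_snd
  | succ n ih =>
    have hwn : Measurable fun z : (ℕ → ℝ) × ℝ => z.1 n :=
      (measurable_pi_apply n).comp measurable_fst
    exact ih.comp (measurable_fst.prodMk (measurable_moebius.comp (hwn.prodMk measurable_snd)))

theorem measurable_contFrac : Measurable contFrac :=
  (StronglyMeasurable.limUnder fun n =>
    ((measurable_Z n).comp measurable_prodMk_right).stronglyMeasurable).measurable

theorem Z_seqCons (a : ℝ) (w : ℕ → ℝ) (n : ℕ) (x : ℝ) :
    Z (seqCons (a, w)) (n + 1) x = moebius a (Z w n x) := by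
  rw [add_comm, Z_add]
  simp only [add_comm 1, seqCons, Z]

variable {β : ℕ → Measure ℝ} [∀ n, IsProbabilityMeasure (β n)]

theorem ae_tendsto_Z_infinitePi (hβ : ∀ n, ∀ᵐ w ∂β n, 0 ≤ w)
    (hsum : ∑' n, β n (Set.Iic 1) = ⊤) :
    ∀ᵐ w ∂Measure.infinitePi β, ∀ x : ℕ → ℝ, (∀ n, 0 ≤ x n) →
      Tendsto (fun n => Z w n (x n)) atTop (𝓝 (contFrac w)) := by
  filter_upwards [ae_forall_infinitePi hβ, ae_frequently_mem_infinitePi measurableSet_Iic hsum]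
    with w hw hf x hx using tendsto_Z hw hf hx

variable {μ : ℕ → Measure ℝ} [∀ n, IsProbabilityMeasure (μ n)]

theorem measurePreserving_Z
    (hstep : ∀ n, ((β n).prod (μ (n + 1))).map (fun z => moebius z.1 z.2) = μ n) (n : ℕ) :
    MeasurePreserving (fun z : (ℕ → ℝ) × ℝ => Z z.1 n z.2)
      ((Measure.infinitePi β).prod (μ n)) (μ 0) := by
  induction n generalizing β μ with
  | zero => exact measurePreserving_snd
  | succ n ih =>
    have hcons := (measurePreserving_seqCons β).prod (MeasurePreserving.id (μ (n + 1)))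
    have htail := ((MeasurePreserving.id (β 0)).prod (ih (β := fun n => β (n + 1))
      (μ := fun n => μ (n + 1)) fun n => hstep (n + 1))).comp
        (measurePreserving_prodAssoc (β 0) (Measure.infinitePi fun n => β (n + 1)) (μ (n + 1)))
    have hhead : MeasurePreserving (fun z : ℝ × ℝ => moebius z.1 z.2) ((β 0).prod (μ 1)) (μ 0) :=
      ⟨measurable_moebius, hstep 0⟩
    rw [← hcons.map_eq]
    refine MeasurePreserving.map_of_comp ?_ (measurable_Z (n + 1)) hcons.measurable
    convert hhead.comp htail using 1
    ext z
    exact Z_seqCons z.1.1 z.1.2 n z.2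

-- With an independent starting point `x n ∼ μ n`, the law of `Z w n (x n)` is `μ 0` for all `n`,
-- while the limit does not depend on the starting points.
theorem hasLaw_contFrac_infinitePi (hβ : ∀ n, ∀ᵐ w ∂β n, 0 ≤ w)
    (hsum : ∑' n, β n (Set.Iic 1) = ⊤) (hμ : ∀ n, ∀ᵐ x ∂μ n, 0 ≤ x)
    (hstep : ∀ n, ((β n).prod (μ (n + 1))).map (fun z => moebius z.1 z.2) = μ n) :
    HasLaw contFrac (μ 0) (Measure.infinitePi β) := by
  set Q : Measure ((ℕ → ℝ) × (ℕ → ℝ)) := (Measure.infinitePi β).prod (Measure.infinitePi μ)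
  have hZ : ∀ n, HasLaw (fun z : (ℕ → ℝ) × (ℕ → ℝ) => Z z.1 n (z.2 n)) (μ 0) Q := fun n =>
    ((measurePreserving_Z hstep n).comp ((MeasurePreserving.id _).prod
      (measurePreserving_eval_infinitePi μ n))).hasLaw
  have hlim : ∀ᵐ z ∂Q, Tendsto (fun n => Z z.1 n (z.2 n)) atTop (𝓝 (contFrac z.1)) := by
    filter_upwards [Measure.quasiMeasurePreserving_fst.ae (ae_tendsto_Z_infinitePi hβ hsum),
      Measure.quasiMeasurePreserving_snd.ae (ae_forall_infinitePi hμ)] with z hz hx using hz z.2 hx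
  have hfst : MeasurePreserving Prod.fst Q (Measure.infinitePi β) := measurePreserving_fst
  rw [← hfst.map_eq]
  exact (MeasurePreserving.map_of_comp ⟨measurable_contFrac.comp measurable_fst,
    (hasLaw_of_ae_tendsto hZ hlim).map_eq⟩ measurable_contFrac measurable_fst).hasLaw

end RandomContinuedFraction

/-! ### The edges of the graph -/

section Edges

-- The two edges issued from a vertex are exchanged by swapping `θ₄` and `θ₅`.
theorem IsAcceptable.exists_succ₁ {v v' : Triple} (h : IsAcceptable v v') :
    ∃ θ : Fin 5 → ℝ, v = triple θ ∧ v' = succ₁ θ ∧ 0 < θ 1 + θ 2 ∧ 0 < θ 0 + θ 4 := by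
  obtain ⟨θ, hv, h12, ⟨hv', h0⟩ | ⟨hv', h0⟩⟩ := h
  · exact ⟨θ, hv, hv', h12, h0⟩
  · exact ⟨![θ 0, θ 1, θ 2, θ 4, θ 3], by simp [hv, triple, Sym2.eq_swap],
      by simp [hv', succ₁, succ₂], h12, h0⟩

theorem IsAcceptable.exists_betaPrime {v v' : Triple} (h : IsAcceptable v v') :
    ∃ c d : ℝ, 0 < c ∧ 0 < d ∧ edgeLaw v v' = betaPrime c d := by
  obtain ⟨θ, rfl, rfl, h12, h04⟩ := h.exists_succ₁
  exact ⟨_, _, h04, h12, edgeLaw_succ₁ θ⟩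

theorem IsAcceptable.isProbabilityMeasure_edgeLaw {v v' : Triple} (h : IsAcceptable v v') :
    IsProbabilityMeasure (edgeLaw v v') := by
  obtain ⟨c, d, hc, hd, hlaw⟩ := h.exists_betaPrime
  exact hlaw ▸ isProbabilityMeasure_betaPrime hc hd

theorem triple_succ₁ (θ : Fin 5 → ℝ) : triple ![θ 4, θ 3, θ 0, θ 1, θ 2] = succ₁ θ := by
  simp [triple, succ₁, Sym2.eq_swap]

theorem map_moebius_BHθ {θ : Fin 5 → ℝ} (hadm : ThetaAdmissible θ) (h12 : 0 < θ 1 + θ 2)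
    (h04 : 0 < θ 0 + θ 4) :
    ((betaPrime (θ 0 + θ 4) (θ 1 + θ 2)).prod (BHθ θ)).map (fun z => moebius z.1 z.2) =
      BHθ ![θ 4, θ 3, θ 0, θ 1, θ 2] := by
  rw [BHθ, map_moebius_BH hadm h04 h12 (by ring) (by ring)]
  simp only [BHθ, Matrix.cons_val]
  congr 1 <;> ring

theorem IsAcceptable.map_moebius_edgeLaw {v v' : Triple} (h : IsAcceptable v v')
    {θ θ' : Fin 5 → ℝ} (hv : triple θ = v) (hθ : ThetaAdmissible θ) (hv' : triple θ' = v')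
    (hθ' : ThetaAdmissible θ') :
    ((edgeLaw v v').prod (BHθ θ)).map (fun z => moebius z.1 z.2) = BHθ θ' := by
  obtain ⟨η, rfl, rfl, h12, h04⟩ := h.exists_succ₁
  obtain ⟨hη, hlaw⟩ := hθ.congr_triple hv
  rw [(hθ'.congr_triple (hv'.trans (triple_succ₁ η).symm)).2, hlaw, edgeLaw_succ₁]
  exact map_moebius_BHθ hη h12 h04

theorem ae_pos_edgeLaw (v v' : Triple) : ∀ᵐ w ∂edgeLaw v v', 0 < w :=
  (withDensity_absolutelyContinuous _ _).ae_le (ae_restrict_mem measurableSet_Ioi)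

theorem betaPrime_Iic_one_pos {c d : ℝ} (hc : 0 < c) (hd : 0 < d) :
    0 < betaPrime c d (Set.Iic 1) := by
  have := beta_pos hc hd
  have hdens : Set.Ioo (0 : ℝ) 1 ⊆ Function.support fun w : ℝ =>
      ENNReal.ofReal (1 / beta c d * (w ^ (c - 1) / (1 + w) ^ (c + d))) := fun w hw => by
    have := hw.1
    exact (ENNReal.ofReal_pos.2 (by positivity)).ne'
  refine lt_of_lt_of_le ?_ (measure_mono fun w (hw : w ∈ Set.Ioo (0 : ℝ) 1) => hw.2.le)
  rw [betaPrime, withDensity_apply _ measurableSet_Ioo, Measure.restrict_restrict measurableSet_Ioo,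
    Set.inter_eq_left.2 Set.Ioo_subset_Ioi_self, setLIntegral_pos_iff (by fun_prop),
    Set.inter_eq_right.2 hdens, Real.volume_Ioo]
  norm_num

theorem finite_Vert (θ : Fin 5 → ℝ) : (Vert θ).Finite :=
  (Set.finite_range fun σ : Equiv.Perm (Fin 5) => triple (θ ∘ σ)).subset
    fun _ ⟨σ, hσ⟩ => ⟨σ, hσ.symm⟩

-- The graph is finite, so only finitely many of these probabilities are distinct.
theorem tsum_edgeLaw_Iic_one_eq_top {θ : Fin 5 → ℝ} {v : ℕ → Vert θ}
    (hv : ∀ n, IsAcceptable (v (n + 1)).1 (v n).1) :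
    ∑' n, edgeLaw (v (n + 1)).1 (v n).1 (Set.Iic 1) = ⊤ := by
  set f : Vert θ × Vert θ → ENNReal := fun e => edgeLaw e.1.1 e.2.1 (Set.Iic 1)
  have : Finite (Vert θ) := finite_Vert θ
  have hfin : (Set.range fun n => f (v (n + 1), v n)).Finite :=
    (Set.finite_range f).subset (Set.range_comp_subset_range _ f)
  obtain ⟨_, ⟨N, rfl⟩, hmin⟩ := Set.exists_min_image _ id hfin (Set.range_nonempty _)
  obtain ⟨c, d, hc, hd, hlaw⟩ := (hv N).exists_betaPrime
  have hpos : f (v (N + 1), v N) ≠ 0 := by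
    simp only [f, hlaw]
    exact (betaPrime_Iic_one_pos hc hd).ne'
  rw [eq_top_iff, ← ENNReal.tsum_const_eq_top_of_ne_zero (α := ℕ) hpos]
  exact ENNReal.tsum_le_tsum fun n => hmin _ ⟨n, rfl⟩

end Edges

end BetaHyp

end

/-- The variable `W n` below is the `(n+1)`-st one of the sequence `W₁, W₂, …`, so that it belongs
to the edge from `v (n+1)` to `v n`. -/
theorem theorem4p2 (θ : Fin 5 → ℝ)
    (v : ℕ → {u : BetaHyp.Vert θ // BetaHyp.BHExists u})
    (hv : ∀ n, (BetaHyp.Gstarstar θ).Adj (v (n + 1)) (v n))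
    {Ω : Type*} [MeasurableSpace Ω] (P : Measure Ω) [IsProbabilityMeasure P]
    (W : ℕ → Ω → ℝ)
    (hind : iIndepFun W P)
    (hW : ∀ n, HasLaw (W n) (BetaHyp.edgeLaw (v (n + 1)).1.1 (v n).1.1) P) :
    ∃ Zlim : Ω → ℝ,
      (∀ᵐ ω ∂P, ∀ x : ℝ, 0 ≤ x →
        Tendsto (fun n => BetaHyp.Z (fun k => W k ω) n x) atTop (𝓝 (Zlim ω))) ∧
      ∀ θ' : Fin 5 → ℝ, BetaHyp.triple θ' = (v 0).1.1 → HasLaw Zlim (BetaHyp.BHθ θ') P := by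
  have hacc : ∀ n, BetaHyp.IsAcceptable (v (n + 1)).1.1 (v n).1.1 := fun n => (hv n).2
  choose η hη hadm using fun n => (v n).2
  have hβ := fun n => (hacc n).isProbabilityMeasure_edgeLaw
  have hBH : ∀ n, IsProbabilityMeasure (BetaHyp.BHθ (η n)) := fun n =>
    BetaHyp.isProbabilityMeasure_BH (hadm n)
  have hpos : ∀ n, ∀ᵐ w ∂BetaHyp.edgeLaw (v (n + 1)).1.1 (v n).1.1, 0 ≤ w := fun n =>
    (BetaHyp.ae_pos_edgeLaw _ _).mono fun _ => le_of_lt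
  have hsum := BetaHyp.tsum_edgeLaw_Iic_one_eq_top (v := fun n => (v n).1) hacc
  have hlaw : HasLaw (fun ω k => W k ω)
      (Measure.infinitePi fun n => BetaHyp.edgeLaw (v (n + 1)).1.1 (v n).1.1) P :=
    hind.hasLaw_infinitePi hW (aemeasurable_pi_iff.2 fun n => (hW n).aemeasurable)
  refine ⟨fun ω => BetaHyp.contFrac fun k => W k ω, ?_, fun θ' hθ' => ?_⟩
  · filter_upwards [ae_of_ae_map hlaw.aemeasurable
      (hlaw.map_eq ▸ BetaHyp.ae_tendsto_Z_infinitePi hpos hsum)] with ω hω x hx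
    exact hω (fun _ => x) fun _ => hx
  · rw [← ((hadm 0).congr_triple ((hη 0).trans hθ'.symm)).2]
    exact (BetaHyp.hasLaw_contFrac_infinitePi (μ := fun n => BetaHyp.BHθ (η n)) hpos hsum
      (fun n => (BetaHyp.ae_mem_Ioo_BH _ _ _ _ _).mono fun _ hx => hx.1.le)
      fun n => (hacc n).map_moebius_edgeLaw (hη _) (hadm _) (hη _) (hadm _)).comp hlaw
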